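/- For $n\in\mathbb N$ let $\Omega_n=\{0,1\}^n$ with uniform measure $\mu$. For $\mathcal A,\mathcal B\subset\Omega_n$ put $I_k(\mathcal A)=2\mu(\{x\in\mathcal A: x\oplus e_k\notin\mathcal A\})$, $\mathcal W_1(\mathcal A,\mathcal B)=\sum_{i=1}^n I_i(\mathcal A)I_i(\mathcal B)$, $\mathrm{Cov}(\mathcal A,\mathcal B)=\mu(\mathcal A\cap\mathcal B)-\mu(\mathcal A)\mu(\mathcal B)$ and $\varphi(x)=x/\log(e/x)$. Talagrand's bound states that $\mathrm{Cov}(\mathcal A,\mathcal B)\ge c\,\varphi(\mathcal W_1(\mathcal A,\mathcal B))$ for increasing $\mathcal A,\mathcal B$ and a universal $c>0$. An (increasing) Hamming ball is a family $\{x:\sum_i x_i>t\}$ with $t\in\mathbb R$; the dual of $\mathcal A$ is $\{x:\bar x\notin\mathcal A\}$, where $\bar x=(1-x_1,\dots,1-x_n)$. Say that a pair of families is tight with constant $K$ if both families are increasing, $\mathrm{Cov}\le K\varphi(\mathcal W_1)$ and $\varphi(\mathcal W_1)\le K\,\mathrm{Cov}$. **Proposition.** There are universal constants $a_0>0$ and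 $K>0$ such that the following holds for every $0<a<a_0$. There exist Hamming balls $\mathcal A_n\subset\Omega_n$ with $\mu(\mathcal A_n)\to a$ and Hamming balls $\mathcal B'_n\subset\Omega_{n+1}$ with $\mu(\mathcal B'_n)\to 1-a$ as $n\to\infty$. Let $(\mathcal A_n)$ be any sequence of Hamming balls $\mathcal A_n\subset\Omega_n$ with $\mu(\mathcal A_n)\to a$, and let $\mathcal B_n$ be the dual of $\mathcal A_n$. (a) Let $\mathcal B'_n\subset\Omega_{n+1}$ be any Hamming balls with $\mu(\mathcal B'_n)\to 1-a$, and let $\mathcal A'_n=\{(x_1,\dots,x_n,y): x\in\mathcal A_n\ \vee\ y=1\}\subset\Omega_{n+1}$. Then $(\mathcal A'_n,\mathcal B'_n)$ is tight with constant $K$ for all sufficiently large $n$. (b) There exist $\ell=\ell(n)$ and Hamming balls $\mathcal C_n\subset\Omega_{\ell(n)}$ with $\mu(\mathcal C_n)=1/2$ such that $I_i(\mathcal C_n)/I_j(\mathcal B_n)\to1$ as $n\to\infty$, uniformly in $i,j$. For every such choice, with $$\mathcal A'_n=\{(x,y)\in\Omega_{n+\ell}: x\in\mathcal A_n\ \vee\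 y_1=1\},\qquad \mathcal B'_n=\{(x,y)\in\Omega_{n+\ell}: x\in\mathcal B_n\ \wedge\ y\in\mathcal C_n\},$$ the pair $(\mathcal A'_n,\mathcal B'_n)$ is tight with constant $K$ for all sufficiently large $n$. -/

import Mathlib

open Filter Topology

namespace DiscreteCube

/-- The discrete cube `{0,1}^n`, ordered coordinatewise (`false ≤ true`). -/
abbrev Cube (n : ℕ) : Type := Fin n → Bool

/-- The uniform probability measure of a family `A ⊆ {0,1}^n`. -/
noncomputable def mu {n : ℕ} (A : Finset (Cube n)) : ℝ := (A.card : ℝ) / 2 ^ n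

/-- `x ⊕ e_k`: the point `x` with its `k`-th coordinate flipped. -/
def flip {n : ℕ} (x : Cube n) (k : Fin n) : Cube n := Function.update x k (!(x k))

/-- The influence of the `k`-th variable on `A`: `2 μ {x ∈ A | x ⊕ e_k ∉ A}`. -/
noncomputable def influence {n : ℕ} (A : Finset (Cube n)) (k : Fin n) : ℝ :=
  2 * mu (A.filter fun x => flip x k ∉ A)

/-- `W₁(A,B) = ∑ i, I_i(A) I_i(B)`. -/
noncomputable def W1 {n : ℕ} (A B : Finset (Cube n)) : ℝ :=
  ∑ i : Fin n, influence A i * influence B i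

/-- `Cov(A,B) = μ(A ∩ B) - μ(A) μ(B)`. -/
noncomputable def cov {n : ℕ} (A B : Finset (Cube n)) : ℝ := mu (A ∩ B) - mu A * mu B

/-- `φ(x) = x / log(e/x)`. -/
noncomputable def phi (x : ℝ) : ℝ := x / Real.log (Real.exp 1 / x)

/-- A family is increasing if it is closed under passing to coordinatewise larger points. -/
def Increasing {n : ℕ} (A : Finset (Cube n)) : Prop := IsUpperSet (A : Set (Cube n))

/-- The pair `(A,B)` of increasing families attains Talagrand's lower bound
`Cov(A,B) ≥ c φ(W₁(A,B))` up to the factor `K` (in both directions). -/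
def TightWith (K : ℝ) {n : ℕ} (A B : Finset (Cube n)) : Prop :=
  Increasing A ∧ Increasing B ∧ cov A B ≤ K * phi (W1 A B) ∧ phi (W1 A B) ≤ K * cov A B

/-- An increasing Hamming ball: a family of the form `{x | ∑ x_i > t}`. -/
def IsHammingBall {n : ℕ} (A : Finset (Cube n)) : Prop :=
  ∃ t : ℝ, ∀ x : Cube n, x ∈ A ↔ t < ∑ i : Fin n, if x i = true then (1 : ℝ) else 0

/-- The dual family: `x` belongs to it iff the complement `x̄` does not belong to `A`. -/
def dual {n : ℕ} (A : Finset (Cube n)) : Finset (Cube n) :=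
  Finset.univ.filter fun x => (fun i => !(x i)) ∉ A

/-- `F n = m_a(x_1, …, x_{k n})`: increasing Hamming balls in the cubes `{0,1}^{k n}` whose measure
is `a`. In each dimension only finitely many measures of balls occur, so this is understood
asymptotically: the measures tend to `a` as `n → ∞`. -/
def IsBallSeq (k : ℕ → ℕ) (a : ℝ) (F : ∀ n, Finset (Cube (k n))) : Prop :=
  (∀ n, IsHammingBall (F n)) ∧ Tendsto (fun n => mu (F n)) atTop (𝓝 a)

/-- `C n = m_{1/2}(y_1, …, y_{ℓ n})` is an exactly balanced increasing Hamming ball, and `ℓ n` is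
such that `I_i(C n) ∼ I_j(B n)` for all `i, j` (asymptotic equality, uniformly in `i, j`). -/
def IsMatchingBalanced (B : ∀ n, Finset (Cube n)) (l : ℕ → ℕ) (C : ∀ n, Finset (Cube (l n))) :
    Prop :=
  (∀ n, IsHammingBall (C n) ∧ mu (C n) = 1 / 2) ∧
    ∀ ε : ℝ, 0 < ε → ∀ᶠ n in atTop, ∀ (i : Fin (l n)) (j : Fin n),
      |influence (C n) i - influence (B n) j| ≤ ε * influence (B n) j

/-- `{(x_1, …, x_n, y_1, …, y_l) | x ∈ A ∨ y_1 = 1}`. -/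
def orFirst {n : ℕ} (A : Finset (Cube n)) (l : ℕ) : Finset (Cube (n + l)) :=
  Finset.univ.filter fun z =>
    (fun i : Fin n => z (Fin.castAdd l i)) ∈ A ∨
      ∃ j : Fin l, j.val = 0 ∧ z (Fin.natAdd n j) = true

/-- `{(x_1, …, x_n, y_1, …, y_l) | x ∈ B ∧ y ∈ C}`. -/
def andFamily {n l : ℕ} (B : Finset (Cube n)) (C : Finset (Cube l)) : Finset (Cube (n + l)) :=
  Finset.univ.filter fun z =>
    (fun i : Fin n => z (Fin.castAdd l i)) ∈ B ∧ (fun j : Fin l => z (Fin.natAdd n j)) ∈ C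

end DiscreteCube

/-!
For a Hamming ball `A ⊆ {0,1}^n` all influences agree; write `I` for their common value and `α` for
the measure of `A`. The expectation of `∑ i, ±1` restricted to `A` is `n I / 2`, so the level-one
inequality bounds `n I ^ 2` from above by a multiple of `α ^ 2 log (1 / α)`. Conversely, if
`exp (-n) ≤ α`, then the upper tail of the walk at height `√(n log (1 / α)) / 8` has measure
more than `α`, so it contains `A`, and `n I ^ 2` is also at least a multiple of `α ^ 2 log (1 / α)`.

In both constructions the distinguished coordinate contributes a negligible amount to `W₁`, and the
remaining ones give `W₁ ≍ n I ^ 2`, hence `φ(W₁) ≍ α ^ 2`. The covariances are computed exactly by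
splitting along the distinguished coordinate: in (b), for instance, `Cov` is `α ^ 2 / 4` plus a
nonnegative multiple of the influence of the balanced ball, which tends to `0`.
-/

namespace DiscreteCube

open Finset Real
open scoped BigOperators

variable {n l : ℕ}

/-! ### Expectation and measure -/

lemma expect_insertNth (k : Fin (n + 1)) (f : Cube (n + 1) → ℝ) :
    𝔼 x, f x = 𝔼 x : Cube n, (f (k.insertNth true x) + f (k.insertNth false x)) / 2 := by
  rw [← Fintype.expect_equiv (Fin.insertNthEquiv (fun _ => Bool) k)
    (fun p => f (k.insertNth p.1 p.2)) f fun _ => rfl, ← univ_product_univ, expect_product,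
    expect_comm]
  refine expect_congr rfl fun x _ => ?_
  rw [Fintype.expect_eq_sum_div_card, Fintype.sum_bool, Fintype.card_bool, Nat.cast_two]

lemma expect_append (f : Cube (n + l) → ℝ) :
    𝔼 z, f z = 𝔼 x : Cube n, 𝔼 y : Cube l, f (Fin.append x y) := by
  rw [← Fintype.expect_equiv (Fin.appendEquiv n l) (fun p => f (Fin.append p.1 p.2)) f
    fun _ => rfl, ← univ_product_univ, expect_product]

lemma mu_eq_expect (A : Finset (Cube n)) : mu A = 𝔼 x, if x ∈ A then 1 else 0 := by
  simp [mu, Fintype.expect_eq_sum_div_card]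

lemma mu_nonneg (A : Finset (Cube n)) : 0 ≤ mu A := by
  unfold mu
  positivity

lemma mu_mono {A B : Finset (Cube n)} (h : A ⊆ B) : mu A ≤ mu B := by
  unfold mu
  gcongr

lemma mu_union {A B : Finset (Cube n)} (h : Disjoint A B) : mu (A ∪ B) = mu A + mu B := by
  rw [mu, card_union_of_disjoint h, Nat.cast_add, add_div, mu, mu]

lemma mu_inter_add_mu_sdiff (A B : Finset (Cube n)) : mu (A ∩ B) + mu (A \ B) = mu A := by
  rw [add_comm, ← mu_union (disjoint_sdiff_inter A B), sdiff_union_inter]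

lemma mu_univ (n : ℕ) : mu (univ : Finset (Cube n)) = 1 := by
  simp [mu]

lemma mu_compl (A : Finset (Cube n)) : mu Aᶜ = 1 - mu A := by
  rw [← mu_univ n, ← mu_inter_add_mu_sdiff univ A, univ_inter, compl_eq_univ_sdiff]
  ring

lemma mu_le_one (A : Finset (Cube n)) : mu A ≤ 1 :=
  (mu_mono (subset_univ A)).trans_eq (mu_univ n)

/-! ### Weights and sign sums -/

/-- The number of ones of `x`. -/
def weight (x : Cube n) : ℕ := ∑ i, (x i).toNat

/-- The sum of the coordinates of `x` in the `±1` encoding. -/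
noncomputable def signSum (x : Cube n) : ℝ := 2 * weight x - n

lemma weight_insertNth (k : Fin (n + 1)) (b : Bool) (x : Cube n) :
    weight (k.insertNth b x : Cube (n + 1)) = b.toNat + weight x := by
  simp [weight, Fin.sum_univ_succAbove _ k]

lemma weight_append (x : Cube n) (y : Cube l) :
    weight (Fin.append x y) = weight x + weight y := by
  simp [weight, Fin.sum_univ_add]

lemma weight_add_weight_compl (x : Cube n) : weight x + weight xᶜ = n := by
  have toNat_add_not (b : Bool) : b.toNat + (!b).toNat = 1 := by cases b <;> rfl
  simp [weight, ← sum_add_distrib, toNat_add_not]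

lemma weight_mono : Monotone (weight (n := n)) := fun _ _ h =>
  sum_le_sum fun i _ => Bool.toNat_le_toNat (h i)

lemma signSum_insertNth_true (k : Fin (n + 1)) (x : Cube n) :
    signSum (k.insertNth true x : Cube (n + 1)) = signSum x + 1 := by
  simp only [signSum, weight_insertNth, Bool.toNat_true]
  push_cast
  ring

lemma signSum_insertNth_false (k : Fin (n + 1)) (x : Cube n) :
    signSum (k.insertNth false x : Cube (n + 1)) = signSum x - 1 := by
  simp only [signSum, weight_insertNth, Bool.toNat_false]
  push_cast
  ring

lemma signSum_append (x : Cube n) (y : Cube l) :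
    signSum (Fin.append x y) = signSum x + signSum y := by
  simp only [signSum, weight_append]
  push_cast
  ring

lemma signSum_compl (x : Cube n) : signSum xᶜ = -signSum x := by
  have : (weight x + weight xᶜ : ℝ) = n := mod_cast weight_add_weight_compl x
  simp only [signSum]
  linarith

lemma expect_signSum_sq (n : ℕ) : 𝔼 x : Cube n, signSum x ^ 2 = n := by
  induction n with
  | zero => simp [signSum, weight]
  | succ n ih =>
    calc 𝔼 x : Cube (n + 1), signSum x ^ 2 = 𝔼 x : Cube n, (signSum x ^ 2 + 1) := by
          rw [expect_insertNth 0]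
          refine expect_congr rfl fun x _ => ?_
          rw [signSum_insertNth_true, signSum_insertNth_false]
          ring
      _ = (n + 1 : ℕ) := by
          rw [expect_add_distrib, ih, Fintype.expect_const, Nat.cast_succ]

lemma expect_signSum_pow_four_le (n : ℕ) : 𝔼 x : Cube n, signSum x ^ 4 ≤ 3 * (n : ℝ) ^ 2 := by
  induction n with
  | zero => simp [signSum, weight]
  | succ n ih =>
    calc 𝔼 x : Cube (n + 1), signSum x ^ 4
        = 𝔼 x : Cube n, (signSum x ^ 4 + 6 * signSum x ^ 2 + 1) := by
          rw [expect_insertNth 0]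
          refine expect_congr rfl fun x _ => ?_
          rw [signSum_insertNth_true, signSum_insertNth_false]
          ring
      _ = (𝔼 x : Cube n, signSum x ^ 4) + 6 * n + 1 := by
          rw [expect_add_distrib, expect_add_distrib, ← mul_expect, expect_signSum_sq,
            Fintype.expect_const]
      _ ≤ 3 * ((n + 1 : ℕ) : ℝ) ^ 2 := by
          push_cast
          linarith

lemma expect_exp_mul_signSum (n : ℕ) (s : ℝ) :
    𝔼 x : Cube n, exp (s * signSum x) = cosh s ^ n := by
  induction n with
  | zero => simp [signSum, weight]
  | succ n ih =>
    rw [expect_insertNth 0, pow_succ, ← ih, expect_mul]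
    refine expect_congr rfl fun x _ => ?_
    rw [signSum_insertNth_true, signSum_insertNth_false, cosh_eq, mul_add, mul_sub, exp_add,
      exp_sub, exp_neg, mul_one]
    ring

/-! ### Slices and influences -/

/-- The section of `A` on which the `k`-th coordinate takes the value `b`, as a family of points in
the remaining coordinates. -/
def slice (A : Finset (Cube (n + 1))) (k : Fin (n + 1)) (b : Bool) : Finset (Cube n) :=
  {x | k.insertNth b x ∈ A}

lemma mem_slice {A : Finset (Cube (n + 1))} {k : Fin (n + 1)} {b : Bool} {x : Cube n} :
    x ∈ slice A k b ↔ k.insertNth b x ∈ A := by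
  simp [slice]

lemma mu_eq_slices (A : Finset (Cube (n + 1))) (k : Fin (n + 1)) :
    mu A = (mu (slice A k true) + mu (slice A k false)) / 2 := by
  simp only [mu_eq_expect, expect_insertNth k, mem_slice, ← expect_add_distrib, ← expect_div]

lemma flip_insertNth (k : Fin (n + 1)) (b : Bool) (x : Cube n) :
    flip (k.insertNth b x : Cube (n + 1)) k = k.insertNth (!b) x := by
  rw [flip, Fin.insertNth_apply_same, Fin.update_insertNth]

lemma influence_eq_slices (A : Finset (Cube (n + 1))) (k : Fin (n + 1)) :
    influence A k =
      mu (slice A k true \ slice A k false) + mu (slice A k false \ slice A k true) := by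
  have slice_filter (b : Bool) :
      slice (A.filter fun x => flip x k ∉ A) k b = slice A k b \ slice A k (!b) := by
    ext x
    simp only [mem_slice, mem_filter, flip_insertNth, Finset.mem_sdiff]
  rw [influence, mu_eq_slices _ k, slice_filter, slice_filter, Bool.not_true, Bool.not_false]
  ring

lemma influence_nonneg (A : Finset (Cube n)) (k : Fin n) : 0 ≤ influence A k :=
  mul_nonneg zero_le_two (mu_nonneg _)

lemma Increasing.slice_false_subset {A : Finset (Cube (n + 1))} (hA : Increasing A)
    (k : Fin (n + 1)) : slice A k false ⊆ slice A k true := by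
  intro x hx
  rw [mem_slice] at hx ⊢
  exact hA (Fin.insertNth_le_iff.2 ⟨by simp, fun j => by simp⟩) hx

lemma Increasing.influence_eq_sub {A : Finset (Cube (n + 1))} (hA : Increasing A)
    (k : Fin (n + 1)) : influence A k = mu (slice A k true) - mu (slice A k false) := by
  have hsub := hA.slice_false_subset k
  have hmu := mu_inter_add_mu_sdiff (slice A k true) (slice A k false)
  rw [inter_eq_right.2 hsub] at hmu
  rw [influence_eq_slices, sdiff_eq_empty_iff_subset.2 hsub, ← hmu]
  simp [mu]

lemma Increasing.mu_slice_true {A : Finset (Cube (n + 1))} (hA : Increasing A)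
    (k : Fin (n + 1)) : mu (slice A k true) = mu A + influence A k / 2 := by
  rw [hA.influence_eq_sub k, mu_eq_slices A k]
  ring

lemma Increasing.mu_slice_false {A : Finset (Cube (n + 1))} (hA : Increasing A)
    (k : Fin (n + 1)) : mu (slice A k false) = mu A - influence A k / 2 := by
  rw [hA.influence_eq_sub k, mu_eq_slices A k]
  ring

/-! ### Duality -/

lemma mem_dual {A : Finset (Cube n)} {x : Cube n} : x ∈ dual A ↔ xᶜ ∉ A := by
  simp [dual, Pi.compl_def]

lemma mu_filter_compl_mem (A : Finset (Cube n)) : mu {x : Cube n | xᶜ ∈ A} = mu A := by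
  rw [mu, card_bijective compl compl_bijective fun x => by rw [mem_filter_univ], mu]

lemma mu_dual (A : Finset (Cube n)) : mu (dual A) = 1 - mu A := by
  rw [← mu_compl, ← mu_filter_compl_mem Aᶜ]
  congr 1
  ext x
  simp [mem_dual]

lemma mu_eq_half_of_dual_eq_self {A : Finset (Cube n)} (hA : dual A = A) : mu A = 1 / 2 := by
  have := mu_dual A
  rw [hA] at this
  linarith

lemma slice_dual (A : Finset (Cube (n + 1))) (k : Fin (n + 1)) (b : Bool) :
    slice (dual A) k b = dual (slice A k !b) := by
  ext x
  have compl_insertNth : (k.insertNth b x : Cube (n + 1))ᶜ = k.insertNth (!b) xᶜ :=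
    Fin.eq_insertNth_iff.2 ⟨by simp, by ext j; simp [Fin.removeNth]⟩
  rw [mem_slice, mem_dual, mem_dual, mem_slice, compl_insertNth]

lemma influence_dual (A : Finset (Cube n)) (k : Fin n) : influence (dual A) k = influence A k := by
  have mu_dual_sdiff_dual {m : ℕ} (B C : Finset (Cube m)) :
      mu (dual B \ dual C) = mu (C \ B) := by
    rw [← mu_filter_compl_mem (C \ B)]
    congr 1
    ext x
    simp [mem_dual, and_comm]
  cases n with
  | zero => exact k.elim0
  | succ n =>
    simp only [influence_eq_slices, slice_dual, mu_dual_sdiff_dual, Bool.not_true, Bool.not_false]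

protected lemma Increasing.dual {A : Finset (Cube n)} (hA : Increasing A) :
    Increasing (dual A) := by
  intro x y hxy hx
  simp only [mem_coe, mem_dual] at hx ⊢
  exact fun hy => hx (hA (compl_le_compl hxy) hy)

/-! ### Hamming balls -/

/-- The points with at least `m` ones. These are the Hamming balls in the cube, normalised to an
integer threshold. -/
def upperBall (n m : ℕ) : Finset (Cube n) := {x | m ≤ weight x}

lemma mem_upperBall {m : ℕ} {x : Cube n} : x ∈ upperBall n m ↔ m ≤ weight x := by
  simp [upperBall]

lemma isHammingBall_iff {A : Finset (Cube n)} : IsHammingBall A ↔ ∃ m, A = upperBall n m := by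
  have cast_weight (x : Cube n) : ∑ i, (if x i = true then (1 : ℝ) else 0) = weight x := by
    simp [weight, Bool.toNat, Bool.cond_eq_ite]
  simp only [IsHammingBall, cast_weight, Finset.ext_iff, mem_upperBall]
  constructor
  · rintro ⟨t, ht⟩
    obtain ht₀ | ht₀ := lt_or_ge t 0
    · exact ⟨0, fun x => iff_of_true ((ht x).2 (ht₀.trans_le (Nat.cast_nonneg _))) (zero_le)⟩
    · exact ⟨⌊t⌋₊ + 1, fun x => by rw [ht, Nat.succ_le_iff, Nat.floor_lt ht₀]⟩
  · rintro ⟨m, hm⟩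
    refine ⟨m - 1, fun x => ?_⟩
    rw [hm, sub_lt_iff_lt_add, ← Nat.cast_succ, Nat.cast_lt, Nat.lt_succ_iff]

lemma isHammingBall_upperBall (n m : ℕ) : IsHammingBall (upperBall n m) :=
  isHammingBall_iff.2 ⟨m, rfl⟩

lemma upperBall_antitone (n : ℕ) : Antitone (upperBall n) := fun _ _ h _ hx =>
  mem_upperBall.2 (h.trans (mem_upperBall.1 hx))

lemma upperBall_zero (n : ℕ) : upperBall n 0 = univ := by
  simp [upperBall]

lemma upperBall_eq_empty {m : ℕ} (h : n < m) : upperBall n m = ∅ := by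
  ext x
  have := weight_add_weight_compl x
  simp only [mem_upperBall, notMem_empty, iff_false]
  omega

lemma IsHammingBall.increasing {A : Finset (Cube n)} (hA : IsHammingBall A) : Increasing A := by
  obtain ⟨m, rfl⟩ := isHammingBall_iff.1 hA
  intro x y hxy hx
  exact mem_upperBall.2 ((mem_upperBall.1 hx).trans (weight_mono hxy))

lemma IsHammingBall.subset_of_mu_lt {A B : Finset (Cube n)} (hA : IsHammingBall A)
    (hB : IsHammingBall B) (h : mu A < mu B) : A ⊆ B := by
  obtain ⟨m, rfl⟩ := isHammingBall_iff.1 hA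
  obtain ⟨m', rfl⟩ := isHammingBall_iff.1 hB
  refine upperBall_antitone n (le_of_not_ge fun hm => h.not_ge ?_)
  exact mu_mono (upperBall_antitone n hm)

lemma dual_upperBall (n m : ℕ) : dual (upperBall n m) = upperBall n (n + 1 - m) := by
  ext x
  have := weight_add_weight_compl x
  rw [mem_dual, mem_upperBall, mem_upperBall]
  omega

protected lemma IsHammingBall.dual {A : Finset (Cube n)} (hA : IsHammingBall A) :
    IsHammingBall (dual A) := by
  obtain ⟨m, rfl⟩ := isHammingBall_iff.1 hA
  exact isHammingBall_iff.2 ⟨_, dual_upperBall n m⟩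

lemma slice_upperBall (n m : ℕ) (k : Fin (n + 1)) (b : Bool) :
    slice (upperBall (n + 1) m) k b = upperBall n (m - b.toNat) := by
  ext x
  rw [mem_slice, mem_upperBall, mem_upperBall, weight_insertNth, tsub_le_iff_left]

protected lemma IsHammingBall.slice {A : Finset (Cube (n + 1))} (hA : IsHammingBall A)
    (k : Fin (n + 1)) (b : Bool) : IsHammingBall (slice A k b) := by
  obtain ⟨m, rfl⟩ := isHammingBall_iff.1 hA
  exact isHammingBall_iff.2 ⟨_, slice_upperBall n m k b⟩

lemma influence_upperBall (n m : ℕ) (k : Fin (n + 1)) :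
    influence (upperBall (n + 1) m) k = mu (upperBall n (m - 1)) - mu (upperBall n m) := by
  rw [(isHammingBall_upperBall _ _).increasing.influence_eq_sub, slice_upperBall, slice_upperBall]
  rfl

lemma IsHammingBall.influence_eq {A : Finset (Cube n)} (hA : IsHammingBall A) (i j : Fin n) :
    influence A i = influence A j := by
  obtain ⟨m, rfl⟩ := isHammingBall_iff.1 hA
  cases n with
  | zero => exact i.elim0
  | succ n => rw [influence_upperBall, influence_upperBall]

/-! ### Dictators -/

/-- The points whose `k`-th coordinate is `1`. -/
def dictator (k : Fin n) : Finset (Cube n) := {x | x k = true}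

lemma mem_dictator {k : Fin n} {x : Cube n} : x ∈ dictator k ↔ x k = true := by
  simp [dictator]

lemma increasing_dictator (k : Fin n) : Increasing (dictator k) := by
  intro x y hxy hx
  simp only [mem_coe, mem_dictator] at hx ⊢
  exact top_le_iff.1 (hx.symm.trans_le (hxy k))

lemma mu_dictator (k : Fin n) : mu (dictator k) = 1 / 2 := by
  refine mu_eq_half_of_dual_eq_self ?_
  ext x
  simp [mem_dual, mem_dictator]

lemma influence_dictator (k j : Fin n) : influence (dictator k) j = if j = k then 1 else 0 := by
  rw [influence]
  split_ifs with hjk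
  · subst hjk
    rw [filter_true_of_mem, mu_dictator, mul_one_div_cancel two_ne_zero]
    intro x hx
    simp [mem_dictator, flip, mem_dictator.1 hx]
  · rw [filter_false_of_mem, mu, card_empty, Nat.cast_zero, zero_div, mul_zero]
    intro x hx
    simpa [mem_dictator, flip, Function.update_of_ne (Ne.symm hjk)] using hx

lemma Increasing.mu_inter_dictator {A : Finset (Cube n)} (hA : Increasing A) (k : Fin n) :
    mu (A ∩ dictator k) = mu A / 2 + influence A k / 4 := by
  cases n with
  | zero => exact k.elim0
  | succ n =>
    have slice_true : slice (A ∩ dictator k) k true = slice A k true := by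
      ext x
      simp [mem_slice, mem_dictator]
    have slice_false : slice (A ∩ dictator k) k false = ∅ := by
      ext x
      simp [mem_slice, mem_dictator]
    rw [mu_eq_slices _ k, slice_true, slice_false, hA.mu_slice_true, mu, mu, card_empty,
      Nat.cast_zero]
    ring

/-! ### Products and disjunctions -/

lemma ext_append {F G : Finset (Cube (n + l))}
    (h : ∀ x y, Fin.append x y ∈ F ↔ Fin.append x y ∈ G) : F = G := by
  ext z
  rw [← Fin.append_castAdd_natAdd (f := z)]
  exact h _ _

lemma mem_andFamily_append {A : Finset (Cube n)} {B : Finset (Cube l)} {x : Cube n} {y : Cube l} :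
    Fin.append x y ∈ andFamily A B ↔ x ∈ A ∧ y ∈ B := by
  simp [andFamily]

lemma mu_andFamily (A : Finset (Cube n)) (B : Finset (Cube l)) :
    mu (andFamily A B) = mu A * mu B := by
  rw [mu_eq_expect, expect_append, mu_eq_expect A, mu_eq_expect B, expect_mul_expect]
  simp only [mem_andFamily_append, ite_and, ite_mul, one_mul, zero_mul]

lemma andFamily_inter_andFamily (A A' : Finset (Cube n)) (B B' : Finset (Cube l)) :
    andFamily A B ∩ andFamily A' B' = andFamily (A ∩ A') (B ∩ B') :=
  ext_append fun x y => by
    simp only [mem_inter, mem_andFamily_append]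
    tauto

protected lemma Increasing.andFamily {A : Finset (Cube n)} {B : Finset (Cube l)} (hA : Increasing A)
    (hB : Increasing B) : Increasing (andFamily A B) := by
  intro z w hzw hz
  simp only [DiscreteCube.andFamily, coe_filter, mem_univ, true_and, Set.mem_ofPred_eq] at hz ⊢
  exact ⟨hA (fun i => hzw _) hz.1, hB (fun j => hzw _) hz.2⟩

lemma flip_append_castAdd (x : Cube n) (y : Cube l) (i : Fin n) :
    flip (Fin.append x y) (Fin.castAdd l i) = Fin.append (flip x i) y := by
  ext k
  induction k using Fin.addCases with
  | left k => simp [flip, Function.update_apply]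
  | right k =>
    have hki : n + (k : ℕ) ≠ i := by omega
    simp [flip, Fin.ext_iff, hki]

lemma flip_append_natAdd (x : Cube n) (y : Cube l) (j : Fin l) :
    flip (Fin.append x y) (Fin.natAdd n j) = Fin.append x (flip y j) := by
  ext k
  induction k using Fin.addCases with
  | left k =>
    have hkj : (k : ℕ) ≠ n + j := by omega
    simp [flip, Fin.ext_iff, hkj]
  | right k => simp [flip, Function.update_apply]

lemma influence_andFamily_castAdd (A : Finset (Cube n)) (B : Finset (Cube l)) (i : Fin n) :
    influence (andFamily A B) (Fin.castAdd l i) = influence A i * mu B := by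
  rw [influence, influence, mul_assoc, ← mu_andFamily]
  congr 2
  refine ext_append fun x y => ?_
  simp only [mem_filter, flip_append_castAdd, mem_andFamily_append]
  tauto

lemma influence_andFamily_natAdd (A : Finset (Cube n)) (B : Finset (Cube l)) (j : Fin l) :
    influence (andFamily A B) (Fin.natAdd n j) = mu A * influence B j := by
  rw [influence, influence, mul_left_comm, ← mu_andFamily]
  congr 2
  refine ext_append fun x y => ?_
  simp only [mem_filter, flip_append_natAdd, mem_andFamily_append]
  tauto

lemma mem_orFirst_append {A : Finset (Cube n)} {x : Cube n} {y : Cube (l + 1)} :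
    Fin.append x y ∈ orFirst A (l + 1) ↔ x ∈ A ∨ y 0 = true := by
  simp [orFirst]

lemma orFirst_eq_dual (A : Finset (Cube n)) (l : ℕ) :
    orFirst A (l + 1) = dual (andFamily (dual A) (dictator (0 : Fin (l + 1)))) :=
  ext_append fun x y => by
    have compl_append : (Fin.append x y)ᶜ = Fin.append xᶜ yᶜ := by
      ext j
      induction j using Fin.addCases <;> simp
    rw [mem_orFirst_append, mem_dual, compl_append, mem_andFamily_append, mem_dual, compl_compl,
      mem_dictator]
    simp [imp_iff_not_or]

protected lemma Increasing.orFirst {A : Finset (Cube n)} (hA : Increasing A) (l : ℕ) :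
    Increasing (orFirst A (l + 1)) := by
  rw [orFirst_eq_dual]
  exact (hA.dual.andFamily (increasing_dictator 0)).dual

lemma mu_orFirst (A : Finset (Cube n)) (l : ℕ) : mu (orFirst A (l + 1)) = (1 + mu A) / 2 := by
  rw [orFirst_eq_dual, mu_dual, mu_andFamily, mu_dual, mu_dictator]
  ring

lemma W1_orFirst (A : Finset (Cube n)) (F : Finset (Cube (n + (l + 1)))) :
    W1 (orFirst A (l + 1)) F =
      (∑ i, influence A i * influence F (Fin.castAdd (l + 1) i)) / 2 +
        (1 - mu A) * influence F (Fin.natAdd n 0) := by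
  simp only [W1, orFirst_eq_dual, influence_dual, Fin.sum_univ_add, influence_andFamily_castAdd,
    influence_andFamily_natAdd, influence_dictator, mu_dictator, mu_dual, mul_ite, ite_mul, mul_one,
    mul_zero, zero_mul, sum_ite_eq', mem_univ, if_true, sum_div]
  congr 1
  exact sum_congr rfl fun i _ => by ring

lemma Increasing.cov_orFirst {F : Finset (Cube (n + (l + 1)))} (hF : Increasing F)
    (A : Finset (Cube n)) :
    cov (orFirst A (l + 1)) F = influence F (Fin.natAdd n 0) / 4 +
      mu (F ∩ andFamily A (dictator 0)ᶜ) - mu A * mu F / 2 := by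
  have inter_eq : orFirst A (l + 1) ∩ F =
      F ∩ dictator (Fin.natAdd n 0) ∪ F ∩ andFamily A (dictator 0)ᶜ :=
    ext_append fun x y => by
      simp only [mem_inter, mem_union, mem_orFirst_append, mem_dictator, mem_andFamily_append,
        mem_compl, Fin.append_right]
      tauto
  have hdisj : Disjoint (F ∩ dictator (Fin.natAdd n 0)) (F ∩ andFamily A (dictator 0)ᶜ) := by
    refine disjoint_left.2 fun z hz hz' => ?_
    rw [← Fin.append_castAdd_natAdd (f := z)] at hz hz'
    simp only [mem_inter, mem_dictator, mem_andFamily_append, mem_compl, Fin.append_right] at hz hz'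
    exact hz'.2.2 hz.2
  rw [cov, inter_eq, mu_union hdisj, hF.mu_inter_dictator, mu_orFirst]
  ring

/-! ### Level-one weight -/

/-- The expectation of `signSum` restricted to `A`, that is, the sum of the level-one Fourier
coefficients of `A`. -/
noncomputable def signMean (A : Finset (Cube n)) : ℝ := 𝔼 x, if x ∈ A then signSum x else 0

lemma Increasing.signMean_eq {A : Finset (Cube n)} (hA : Increasing A) :
    signMean A = (∑ i, influence A i) / 2 := by
  have signSum_eq_sum (x : Cube n) :
      signSum x = ∑ i, (2 * (if x ∈ dictator i then 1 else 0) - 1 : ℝ) := by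
    rw [sum_sub_distrib, ← mul_sum]
    simp [signSum, weight, mem_dictator, Bool.toNat, Bool.cond_eq_ite]
  calc signMean A
      = ∑ i, 𝔼 x, (2 * (if x ∈ A ∩ dictator i then 1 else 0) - if x ∈ A then 1 else 0 : ℝ) := by
        rw [signMean, ← expect_sum_comm]
        refine expect_congr rfl fun x _ => ?_
        by_cases hx : x ∈ A <;> simp [hx, signSum_eq_sum]
    _ = ∑ i, (2 * mu (A ∩ dictator i) - mu A) := by
        simp only [expect_sub_distrib, ← mul_expect, mu_eq_expect]
    _ = (∑ i, influence A i) / 2 := by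
        rw [sum_div]
        refine sum_congr rfl fun i _ => ?_
        rw [hA.mu_inter_dictator]
        ring

lemma IsHammingBall.signMean_eq {A : Finset (Cube n)} (hA : IsHammingBall A) (k : Fin n) :
    signMean A = n * influence A k / 2 := by
  rw [hA.increasing.signMean_eq, sum_congr rfl fun i _ => hA.influence_eq i k]
  simp

lemma mul_mu_le_signMean {A : Finset (Cube n)} {r : ℝ} (h : ∀ x ∈ A, r ≤ signSum x) :
    r * mu A ≤ signMean A := by
  rw [mu_eq_expect, mul_expect, signMean]
  refine expect_le_expect fun x _ => ?_
  split_ifs with hx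
  · simpa using h x hx
  · simp

lemma mul_signMean_le {A : Finset (Cube n)} (hA : 0 < mu A) (s : ℝ) :
    s * signMean A ≤ mu A * (n * s ^ 2 / 2 + log (mu A)⁻¹) := by
  set c := n * s ^ 2 / 2 + log (mu A)⁻¹ with hc
  have exp_c : exp c = exp (n * s ^ 2 / 2) / mu A := by
    rw [hc, exp_add, exp_log (inv_pos.2 hA), ← div_eq_mul_inv]
  -- The tangent line of `exp` at `c` makes this Jensen's inequality on `A`.
  have tangent (t : ℝ) : exp c * (1 - c + t) ≤ exp t := by
    calc exp c * (1 - c + t) ≤ exp c * exp (t - c) := by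
          gcongr
          linarith [add_one_le_exp (t - c)]
      _ = exp t := by rw [← exp_add, add_sub_cancel]
  have key : exp c * ((1 - c) * mu A + s * signMean A) ≤ exp (n * s ^ 2 / 2) := by
    calc exp c * ((1 - c) * mu A + s * signMean A)
        = 𝔼 x : Cube n, if x ∈ A then exp c * (1 - c + s * signSum x) else 0 := by
          rw [mu_eq_expect, signMean, mul_expect, mul_expect, ← expect_add_distrib, mul_expect]
          refine expect_congr rfl fun x _ => ?_
          split_ifs <;> ring
      _ ≤ 𝔼 x : Cube n, exp (s * signSum x) := by
          refine expect_le_expect fun x _ => ?_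
          split_ifs
          · exact tangent _
          · positivity
      _ ≤ exp (n * s ^ 2 / 2) := by
          rw [expect_exp_mul_signSum, mul_div_assoc, exp_nat_mul]
          exact pow_le_pow_left₀ (cosh_pos s).le (cosh_le_exp_half_sq s) n
  rw [exp_c, div_mul_eq_mul_div, div_le_iff₀ hA, mul_le_mul_iff_right₀ (exp_pos _)] at key
  linarith

lemma level_one_inequality (A : Finset (Cube n)) :
    signMean A ^ 2 ≤ 2 * n * (mu A ^ 2 * log (mu A)⁻¹) := by
  obtain rfl | hne := A.eq_empty_or_nonempty
  · simp [signMean, mu]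
  have hA : 0 < mu A := by
    have := hne.card_pos
    unfold mu
    positivity
  have := discrim_le_zero (a := mu A * n / 2) (b := -signMean A) (c := mu A * log (mu A)⁻¹)
    fun s => by linarith [mul_signMean_le hA s]
  rw [discrim] at this
  linarith

lemma IsHammingBall.mul_influence_sq_le {A : Finset (Cube n)} (hA : IsHammingBall A)
    (k : Fin n) : n * influence A k ^ 2 ≤ 8 * (mu A ^ 2 * log (mu A)⁻¹) := by
  have hn : (0 : ℝ) < n := Nat.cast_pos.2 k.pos
  have := level_one_inequality A
  rw [hA.signMean_eq k] at this
  nlinarith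

lemma IsHammingBall.influence_le_sqrt {A : Finset (Cube n)} (hA : IsHammingBall A) (k : Fin n) :
    influence A k ≤ √(8 / n) := by
  have hn : (0 : ℝ) < n := Nat.cast_pos.2 k.pos
  refine le_sqrt_of_sq_le ((le_div_iff₀' hn).2 ((hA.mul_influence_sq_le k).trans ?_))
  have h₀ := mu_nonneg A
  calc 8 * (mu A ^ 2 * log (mu A)⁻¹) ≤ 8 * (mu A ^ 2 * (mu A)⁻¹) := by
        gcongr
        exact log_le_self (inv_nonneg.2 h₀)
    _ = 8 * mu A := by rw [sq, mul_self_mul_inv]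
    _ ≤ 8 := by linarith [mu_le_one A]

/-! ### Lower bounds for tails -/

/-- The event that the `±1` walk `signSum` ends at height at least `r`. -/
noncomputable def tail (n : ℕ) (r : ℝ) : Finset (Cube n) := {x | r ≤ signSum x}

lemma mem_tail {r : ℝ} {x : Cube n} : x ∈ tail n r ↔ r ≤ signSum x := by
  simp [tail]

lemma isHammingBall_tail (n : ℕ) (r : ℝ) : IsHammingBall (tail n r) := by
  refine isHammingBall_iff.2 ⟨⌈(r + n) / 2⌉₊, ?_⟩
  ext x
  rw [mem_tail, mem_upperBall, Nat.ceil_le, signSum, le_sub_iff_add_le, div_le_iff₀' two_pos]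

lemma half_le_mu_tail_zero (n : ℕ) : 1 / 2 ≤ mu (tail n 0) := by
  have dual_subset : dual (tail n 0) ⊆ tail n 0 := fun x hx => by
    rw [mem_dual, mem_tail, signSum_compl] at hx
    rw [mem_tail]
    linarith
  have := mu_mono dual_subset
  rw [mu_dual] at this
  linarith

lemma mu_tail_add (n l : ℕ) (r s : ℝ) :
    mu (tail n r) * mu (tail l s) ≤ mu (tail (n + l) (r + s)) := by
  rw [← mu_andFamily]
  refine mu_mono fun z hz => ?_
  rw [← Fin.append_castAdd_natAdd (f := z)] at hz ⊢
  rw [mem_andFamily_append, mem_tail, mem_tail] at hz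
  rw [mem_tail, signSum_append]
  exact add_le_add hz.1 hz.2

lemma paley_zygmund {ι : Type*} [Fintype ι] [Nonempty ι] {f : ι → ℝ} {θ : ℝ} (hθ₀ : 0 ≤ θ)
    (hθ₁ : θ ≤ 1) (hf : 0 ≤ 𝔼 i, f i) :
    ((1 - θ) * 𝔼 i, f i) ^ 2 ≤
      (𝔼 i, f i ^ 2) * 𝔼 i, if θ * 𝔼 j, f j ≤ f i then 1 else 0 := by
  set m := 𝔼 i, f i
  have split : m ≤ θ * m + 𝔼 i, f i * if θ * m ≤ f i then 1 else 0 := by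
    calc m ≤ 𝔼 i, (θ * m + f i * if θ * m ≤ f i then 1 else 0) := by
          refine expect_le_expect fun i _ => ?_
          have := mul_nonneg hθ₀ hf
          split_ifs <;> linarith
      _ = θ * m + 𝔼 i, f i * if θ * m ≤ f i then 1 else 0 := by
          rw [expect_add_distrib, Fintype.expect_const]
  calc ((1 - θ) * m) ^ 2 ≤ (𝔼 i, f i * if θ * m ≤ f i then 1 else 0) ^ 2 := by
        have := mul_nonneg (sub_nonneg.2 hθ₁) hf
        gcongr
        linarith
    _ ≤ (𝔼 i, f i ^ 2) * 𝔼 i, (if θ * m ≤ f i then 1 else 0) ^ 2 := expect_mul_sq_le_sq_mul_sq ..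
    _ = (𝔼 i, f i ^ 2) * 𝔼 i, if θ * m ≤ f i then 1 else 0 := by simp [ite_pow]

lemma le_mu_tail_sqrt (n : ℕ) : 3 / 32 ≤ mu (tail n (√n / 2)) := by
  obtain rfl | hn := n.eq_zero_or_pos
  · have := half_le_mu_tail_zero 0
    norm_num
    linarith
  set T := tail n (√n / 2)
  have two_sided : (𝔼 x : Cube n, if 1 / 4 * (n : ℝ) ≤ signSum x ^ 2 then 1 else 0) ≤ 2 * mu T := by
    calc (𝔼 x : Cube n, if 1 / 4 * (n : ℝ) ≤ signSum x ^ 2 then 1 else 0 : ℝ)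
        ≤ 𝔼 x : Cube n, ((if x ∈ T then 1 else 0) + if x ∈ (dual T)ᶜ then 1 else 0) := by
          refine expect_le_expect fun x _ => ?_
          have : 1 / 4 * (n : ℝ) ≤ signSum x ^ 2 → x ∈ T ∨ x ∈ (dual T)ᶜ := fun h => by
            rw [mem_compl, mem_dual, not_not, mem_tail, mem_tail, signSum_compl, ← le_abs]
            refine (le_abs_self _).trans (sq_le_sq.1 ?_)
            rw [div_pow, sq_sqrt n.cast_nonneg]
            linarith
          by_cases h : 1 / 4 * (n : ℝ) ≤ signSum x ^ 2
          · obtain hx | hx := this h <;> simp only [h, hx, if_true] <;> split_ifs <;> norm_num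
          · rw [if_neg h]
            positivity
      _ = 2 * mu T := by
          rw [expect_add_distrib, ← mu_eq_expect, ← mu_eq_expect, mu_compl, mu_dual]
          ring
  have pz := paley_zygmund (f := fun x : Cube n => signSum x ^ 2) (θ := 1 / 4) (by norm_num)
    (by norm_num) (by rw [expect_signSum_sq]; positivity)
  simp only [expect_signSum_sq, ← pow_mul] at pz
  have hn' : (0 : ℝ) < n := Nat.cast_pos.2 hn
  have : ((1 - 1 / 4) * (n : ℝ)) ^ 2 ≤ 3 * (n : ℝ) ^ 2 * (2 * mu T) :=
    pz.trans (mul_le_mul (expect_signSum_pow_four_le n) two_sided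
      (expect_nonneg fun _ _ => by positivity) (by positivity))
  refine le_of_mul_le_mul_left ?_ (pow_pos hn' 2)
  linarith

lemma mu_tail_pow_le (n k : ℕ) (r : ℝ) : mu (tail n r) ^ k ≤ mu (tail (n * k) (k * r)) := by
  induction k with
  | zero => simp [tail, signSum, weight, mu]
  | succ k ih =>
    calc mu (tail n r) ^ (k + 1) ≤ mu (tail (n * k) (k * r)) * mu (tail n r) := by
          rw [pow_succ]
          gcongr
          exact mu_nonneg _
      _ ≤ mu (tail (n * (k + 1)) ((k + 1 : ℕ) * r)) := by
          rw [Nat.cast_succ, add_one_mul]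
          exact mu_tail_add _ _ _ _

/-- The steps are cut into `k` blocks of length `n / k`, each of which gains half a standard
deviation. -/
lemma exp_neg_le_mu_tail (n k : ℕ) :
    exp (-(3 * k + 1)) ≤ mu (tail n (k * (√(n / k : ℕ) / 2))) := by
  have exp_neg_three : exp (-3) ≤ 3 / 32 := by
    rw [exp_neg, inv_le_comm₀ (exp_pos _) (by norm_num)]
    calc (3 / 32)⁻¹ ≤ (2.7 : ℝ) ^ 3 := by norm_num
      _ ≤ exp 1 ^ 3 := by
          gcongr
          linarith [exp_one_gt_d9]
      _ = exp 3 := by rw [← exp_nat_mul]; norm_num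
  have exp_neg_one : exp (-1) ≤ 1 / 2 := by
    rw [exp_neg, inv_le_comm₀ (exp_pos _) (by norm_num)]
    linarith [exp_one_gt_d9]
  calc exp (-(3 * k + 1)) = exp (-3) ^ k * exp (-1) := by
        rw [← exp_nat_mul, ← exp_add]
        ring_nf
    _ ≤ mu (tail (n / k) (√(n / k : ℕ) / 2)) ^ k * mu (tail (n % k) 0) := by
        gcongr
        · exact pow_nonneg (mu_nonneg _) k
        · exact exp_neg_three.trans (le_mu_tail_sqrt _)
        · exact exp_neg_one.trans (half_le_mu_tail_zero _)
    _ ≤ mu (tail (n / k * k) (k * (√(n / k : ℕ) / 2))) * mu (tail (n % k) 0) := by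
        gcongr
        · exact mu_nonneg _
        · exact mu_tail_pow_le _ _ _
    _ ≤ mu (tail n (k * (√(n / k : ℕ) / 2))) := by
        have := mu_tail_add (n / k * k) (n % k) (k * (√(n / k : ℕ) / 2)) 0
        rwa [Nat.div_add_mod', add_zero] at this

lemma exp_neg_lt_mu_tail {L : ℝ} (hL : 8 ≤ L) (hn : L ≤ n) :
    exp (-L) < mu (tail n (√(n * L) / 8)) := by
  set k := ⌊(L - 2) / 3⌋₊
  have k_le : 3 * (k : ℝ) + 2 ≤ L := by
    have := Nat.floor_le (a := (L - 2) / 3) (by linarith)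
    linarith
  have le_k : L / 8 ≤ k := by
    have := Nat.lt_floor_add_one ((L - 2) / 3)
    linarith
  have le_blocks : (n : ℝ) ≤ 2 * (k * (n / k : ℕ)) := by
    have hkn : k ≤ n := by
      rify
      linarith
    have hk₀ : 0 < k := by
      rify
      linarith
    have := Nat.lt_mul_div_succ n hk₀
    have := Nat.mul_le_mul_left k (Nat.div_pos hkn hk₀)
    norm_cast
    lia
  have height_le : √(n * L) / 8 ≤ k * (√(n / k : ℕ) / 2) := by
    have : √(n * L) ≤ 4 * (k * √(n / k : ℕ)) := by
      refine sqrt_le_iff.2 ⟨by positivity, ?_⟩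
      calc n * L ≤ 2 * (k * (n / k : ℕ)) * (8 * k) := by
            gcongr
            linarith
        _ = (4 * (k * √(n / k : ℕ))) ^ 2 := by
            rw [mul_pow, mul_pow, sq_sqrt (Nat.cast_nonneg _)]
            ring
    linarith
  calc exp (-L) < exp (-(3 * k + 1)) := exp_lt_exp.2 (by linarith)
    _ ≤ mu (tail n (k * (√(n / k : ℕ) / 2))) := exp_neg_le_mu_tail n k
    _ ≤ mu (tail n (√(n * L) / 8)) :=
        mu_mono fun x hx => mem_tail.2 (height_le.trans (mem_tail.1 hx))

lemma IsHammingBall.le_mul_influence_sq {A : Finset (Cube n)} (hA : IsHammingBall A)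
    (hA₁ : exp (-n) ≤ mu A) (hA₂ : mu A ≤ exp (-8)) (k : Fin n) :
    mu A ^ 2 * log (mu A)⁻¹ / 16 ≤ n * influence A k ^ 2 := by
  have hn : (0 : ℝ) < n := Nat.cast_pos.2 k.pos
  have hA₀ : 0 < mu A := (exp_pos _).trans_le hA₁
  set L := log (mu A)⁻¹ with hL
  have mu_eq : mu A = exp (-L) := by rw [hL, log_inv, neg_neg, exp_log hA₀]
  have le_L : 8 ≤ L := by
    rwa [mu_eq, exp_le_exp, neg_le_neg_iff] at hA₂
  have L_le : L ≤ n := by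
    rwa [mu_eq, exp_le_exp, neg_le_neg_iff] at hA₁
  have subset_tail : A ⊆ tail n (√(n * L) / 8) :=
    hA.subset_of_mu_lt (isHammingBall_tail _ _) (mu_eq ▸ exp_neg_lt_mu_tail le_L L_le)
  have mul_mu_le := mul_mu_le_signMean fun x hx => mem_tail.1 (subset_tail hx)
  rw [hA.signMean_eq k] at mul_mu_le
  have := pow_le_pow_left₀ (by positivity) mul_mu_le 2
  rw [mul_pow, div_pow, sq_sqrt (by positivity)] at this
  nlinarith

/-! ### Tightness -/

lemma exp_neg_eight_le : exp (-8) ≤ 1 / 9 := by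
  rw [exp_neg, inv_le_comm₀ (exp_pos _) (by norm_num)]
  linarith [add_one_le_exp 8]

lemma eight_le_log_inv {α : ℝ} (hα₀ : 0 < α) (hα : α ≤ exp (-8)) : 8 ≤ log α⁻¹ := by
  rw [log_inv, le_neg]
  exact (log_le_iff_le_exp hα₀).2 hα

lemma phi_mem_Icc {α W : ℝ} (hα₀ : 0 < α) (hα : α ≤ exp (-8))
    (hW₁ : α ^ 2 * log α⁻¹ / 128 ≤ W) (hW₂ : W ≤ 32 * (α ^ 2 * log α⁻¹)) :
    phi W ∈ Set.Icc (α ^ 2 / 384) (64 * α ^ 2) := by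
  set L := log α⁻¹ with hL
  have log_α : log α = -L := by rw [hL, log_inv, neg_neg]
  have le_L : 8 ≤ L := eight_le_log_inv hα₀ hα
  have hL₀ : 0 < L := by linarith
  have hW₀ : 0 < W := lt_of_lt_of_le (by positivity) hW₁
  have log_eq : log (exp 1 / W) = 1 - log W := by rw [log_div (exp_ne_zero 1) hW₀.ne', log_exp]
  have le_log_W : -2 * L + log L - 7 * log 2 ≤ log W := by
    have := log_le_log (by positivity) hW₁
    rw [log_div (by positivity) (by norm_num), log_mul (by positivity) hL₀.ne', log_pow, log_α,
      show (128 : ℝ) = 2 ^ 7 by norm_num, log_pow] at this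
    push_cast at this
    linarith
  have log_W_le : log W ≤ 5 * log 2 - 2 * L + log L := by
    have := log_le_log hW₀ hW₂
    rw [log_mul (by norm_num) (by positivity), log_mul (by positivity) hL₀.ne', log_pow, log_α,
      show (32 : ℝ) = 2 ^ 5 by norm_num, log_pow] at this
    push_cast at this
    linarith
  have log_two_lt := log_two_lt_d9
  have le_log : L / 2 ≤ log (exp 1 / W) := by
    linarith [log_le_sub_one_of_pos hL₀]
  have log_le : log (exp 1 / W) ≤ 3 * L := by
    linarith [log_nonneg (by linarith : 1 ≤ L)]
  constructor
  · calc α ^ 2 / 384 = α ^ 2 * L / 128 / (3 * L) := by field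
      _ ≤ phi W := by
        unfold phi
        gcongr
        linarith
  · calc phi W ≤ 32 * (α ^ 2 * L) / (L / 2) := by
          unfold phi
          gcongr
      _ = 64 * α ^ 2 := by field

lemma tightWith_of_bounds {A B : Finset (Cube n)} {α : ℝ} (hA : Increasing A) (hB : Increasing B)
    (hα₀ : 0 < α) (hα : α ≤ exp (-8)) (hW₁ : α ^ 2 * log α⁻¹ / 128 ≤ W1 A B)
    (hW₂ : W1 A B ≤ 32 * (α ^ 2 * log α⁻¹)) (hcov₁ : α ^ 2 / 4 ≤ cov A B)
    (hcov₂ : cov A B ≤ 2 * α ^ 2) : TightWith 1000 A B := by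
  obtain ⟨hφ₁, hφ₂⟩ := phi_mem_Icc hα₀ hα hW₁ hW₂
  have := sq_nonneg α
  exact ⟨hA, hB, by linarith, by linarith⟩

lemma sq_mul_log_inv_le {x y : ℝ} (hx : 0 < x) (hy : y ≤ 1 / 2) (hxy : x ≤ 2 * y)
    (hyx : y ≤ 2 * x) : x ^ 2 * log x⁻¹ ≤ 8 * (y ^ 2 * log y⁻¹) := by
  have hy₀ : 0 < y := by linarith
  have log_two_le : log 2 ≤ log y⁻¹ := by
    refine log_le_log two_pos ?_
    rw [le_inv_comm₀ two_pos hy₀]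
    linarith
  have log_le : log x⁻¹ ≤ 2 * log y⁻¹ := by
    calc log x⁻¹ ≤ log (2 * y⁻¹) := by
          refine log_le_log (inv_pos.2 hx) ?_
          rw [← div_eq_mul_inv, inv_le_comm₀ hx (by positivity), inv_div]
          linarith
      _ = log 2 + log y⁻¹ := log_mul two_ne_zero (inv_ne_zero hy₀.ne')
      _ ≤ 2 * log y⁻¹ := by linarith
  calc x ^ 2 * log x⁻¹ ≤ (2 * y) ^ 2 * (2 * log y⁻¹) := by
        gcongr
        exact log_nonneg ((one_le_inv₀ hx).2 (by linarith))
    _ = 8 * (y ^ 2 * log y⁻¹) := by ring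

lemma IsHammingBall.W1_orFirst_andFamily_dual {A : Finset (Cube n)} {C : Finset (Cube (l + 1))}
    (hA : IsHammingBall A) (hC : mu C = 1 / 2) (i : Fin n) :
    W1 (orFirst A (l + 1)) (andFamily (dual A) C) =
      n * influence A i ^ 2 / 4 + (1 - mu A) ^ 2 * influence C 0 := by
  simp only [W1_orFirst, influence_andFamily_castAdd, influence_andFamily_natAdd, influence_dual,
    mu_dual, hC, hA.influence_eq _ i, sum_const, card_univ, Fintype.card_fin, nsmul_eq_mul]
  ring

lemma IsHammingBall.cov_orFirst_andFamily_dual {A : Finset (Cube n)} {C : Finset (Cube (l + 1))}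
    (hA : IsHammingBall A) (hA_half : mu A < 1 / 2) (hC : Increasing C) (hC_half : mu C = 1 / 2) :
    cov (orFirst A (l + 1)) (andFamily (dual A) C) =
      mu A ^ 2 / 4 + (1 - 2 * mu A) * influence C 0 / 4 := by
  have subset_dual : A ⊆ dual A := hA.subset_of_mu_lt hA.dual (by rw [mu_dual]; linarith)
  have mu_sdiff := mu_inter_add_mu_sdiff C (dictator 0)
  rw [hC.mu_inter_dictator] at mu_sdiff
  rw [(hA.dual.increasing.andFamily hC).cov_orFirst, andFamily_inter_andFamily,
    inter_eq_right.2 subset_dual, ← sdiff_eq_inter_compl, influence_andFamily_natAdd,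
    mu_andFamily, mu_andFamily, mu_dual, eq_sub_of_add_eq' mu_sdiff, hC_half]
  ring

lemma mu_ne_half_of_dim_zero (C : Finset (Cube 0)) : mu C ≠ 1 / 2 := by
  rw [mu, pow_zero, div_one, ne_eq, eq_div_iff two_ne_zero]
  norm_cast
  omega

lemma tightWith_orFirst_andFamily_dual {A : Finset (Cube n)} {C : Finset (Cube l)}
    (hA : IsHammingBall A) (hA₁ : exp (-n) ≤ mu A) (hA₂ : mu A ≤ exp (-8)) (hC : Increasing C)
    (hC_half : mu C = 1 / 2) (hC_infl : ∀ i, influence C i ≤ mu A ^ 2) :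
    TightWith 1000 (orFirst A l) (andFamily (dual A) C) := by
  obtain _ | l := l
  · exact absurd hC_half (mu_ne_half_of_dim_zero C)
  have hα₀ : 0 < mu A := (exp_pos _).trans_le hA₁
  have hα : mu A ≤ 1 / 9 := hA₂.trans exp_neg_eight_le
  have hn : 0 < n := by
    have := exp_le_exp.1 (hA₁.trans hA₂)
    rify
    linarith
  have infl_nonneg := influence_nonneg C 0
  have infl_mul_nonneg : 0 ≤ (1 - mu A) ^ 2 * influence C 0 := by positivity
  have infl_mul_le : (1 - mu A) ^ 2 * influence C 0 ≤ mu A ^ 2 :=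
    (mul_le_of_le_one_left infl_nonneg (pow_le_one₀ (by linarith) (by linarith))).trans (hC_infl 0)
  have sq_le : mu A ^ 2 ≤ mu A ^ 2 * log (mu A)⁻¹ :=
    le_mul_of_one_le_right (sq_nonneg _) (by linarith [eight_le_log_inv hα₀ hA₂])
  have le_infl := hA.le_mul_influence_sq hA₁ hA₂ ⟨0, hn⟩
  have infl_le := hA.mul_influence_sq_le ⟨0, hn⟩
  refine tightWith_of_bounds (hA.increasing.orFirst l) (hA.dual.increasing.andFamily hC) hα₀ hA₂
    ?_ ?_ ?_ ?_
  · rw [hA.W1_orFirst_andFamily_dual hC_half ⟨0, hn⟩]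
    linarith
  · rw [hA.W1_orFirst_andFamily_dual hC_half ⟨0, hn⟩]
    linarith
  · rw [hA.cov_orFirst_andFamily_dual (by linarith) hC hC_half]
    have : 0 ≤ (1 - 2 * mu A) * influence C 0 := mul_nonneg (by linarith) infl_nonneg
    linarith
  · rw [hA.cov_orFirst_andFamily_dual (by linarith) hC hC_half]
    have : (1 - 2 * mu A) * influence C 0 ≤ influence C 0 :=
      mul_le_of_le_one_left infl_nonneg (by linarith)
    linarith [hC_infl 0]

lemma IsHammingBall.W1_orFirst_one {A : Finset (Cube n)} {F : Finset (Cube (n + 1))}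
    (hA : IsHammingBall A) (hF : IsHammingBall F) (i : Fin n) :
    W1 (orFirst A 1) F = n * (influence A i * influence F (Fin.last n)) / 2 +
      (1 - mu A) * influence F (Fin.last n) := by
  simp only [W1_orFirst (l := 0), hA.influence_eq _ i, hF.influence_eq _ (Fin.last n), sum_const,
    card_univ, Fintype.card_fin, nsmul_eq_mul]

lemma Increasing.cov_orFirst_one {A : Finset (Cube n)} {F : Finset (Cube (n + 1))}
    (hF : Increasing F) (hAF : A ⊆ slice F (Fin.last n) false) :
    cov (orFirst A 1) F = mu A * (1 - mu F) / 2 + influence F (Fin.last n) / 4 := by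
  have subset_F : andFamily A (dictator (0 : Fin 1))ᶜ ⊆ F := fun z hz => by
    rw [← Fin.append_castAdd_natAdd (f := z)] at hz ⊢
    rw [mem_andFamily_append, mem_compl, mem_dictator, Bool.not_eq_true] at hz
    rw [Fin.append_right_eq_snoc, hz.2, ← Fin.insertNth_last']
    exact mem_slice.1 (hAF hz.1)
  rw [hF.cov_orFirst (l := 0), inter_eq_right.2 subset_F, mu_andFamily, mu_compl, mu_dictator,
    show Fin.natAdd n (0 : Fin 1) = Fin.last n from rfl]
  ring

lemma IsHammingBall.mul_influence_mul_influence_mem_Icc {A : Finset (Cube n)}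
    {F : Finset (Cube (n + 1))} (hA : IsHammingBall A) (hA₁ : exp (-n) ≤ mu A)
    (hA₂ : mu A ≤ exp (-8)) (hF : IsHammingBall F) (hF₁ : exp (-n) ≤ 1 - mu F)
    (hF₂ : 1 - mu F ≤ exp (-8)) (hAF : mu A ≤ 2 * (1 - mu F)) (hFA : 1 - mu F ≤ 2 * mu A)
    (i : Fin n) (j : Fin (n + 1)) :
    n * (influence A i * influence F j) ∈
      Set.Icc (mu A ^ 2 * log (mu A)⁻¹ / 64) (36 * (mu A ^ 2 * log (mu A)⁻¹)) := by
  have hα₀ : 0 < mu A := (exp_pos _).trans_le hA₁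
  have hβ₀ : 0 < 1 - mu F := (exp_pos _).trans_le hF₁
  have hn : (1 : ℝ) ≤ n := Nat.one_le_cast.2 i.pos
  have exp_le : exp (-((n + 1 : ℕ) : ℝ)) ≤ 1 - mu F := (exp_le_exp.2 (by simp)).trans hF₁
  have hI := influence_nonneg A i
  have hJ := influence_nonneg F j
  have le_I := hA.le_mul_influence_sq hA₁ hA₂ i
  have I_le := hA.mul_influence_sq_le i
  have le_J := hF.dual.le_mul_influence_sq (mu_dual F ▸ exp_le) (mu_dual F ▸ hF₂) j
  have J_le := hF.dual.mul_influence_sq_le j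
  rw [mu_dual, influence_dual, Nat.cast_succ] at le_J J_le
  have hαβ := sq_mul_log_inv_le hα₀ (by linarith [exp_neg_eight_le]) hAF hFA
  have hβα := sq_mul_log_inv_le hβ₀ (by linarith [exp_neg_eight_le]) hFA hAF
  have hQ : 0 ≤ mu A ^ 2 * log (mu A)⁻¹ :=
    mul_nonneg (sq_nonneg _) (by linarith [eight_le_log_inv hα₀ hA₂])
  set Q := mu A ^ 2 * log (mu A)⁻¹
  set I := influence A i
  set J := influence F j
  have le_J' : Q / 256 ≤ n * J ^ 2 := by nlinarith [sq_nonneg J]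
  have J_le' : n * J ^ 2 ≤ 64 * Q := by nlinarith [sq_nonneg J]
  constructor
  · rw [← sq_le_sq₀ (by positivity) (by positivity)]
    calc (Q / 64) ^ 2 = Q / 16 * (Q / 256) := by ring
      _ ≤ n * I ^ 2 * (n * J ^ 2) := by gcongr
      _ = (n * (I * J)) ^ 2 := by ring
  · have two_mul_le := mul_le_mul_of_nonneg_left (two_mul_le_add_sq I J) n.cast_nonneg
    linarith

lemma tightWith_orFirst_one {A : Finset (Cube n)} {F : Finset (Cube (n + 1))}
    (hA : IsHammingBall A) (hA₁ : exp (-n) ≤ mu A) (hA₂ : mu A ≤ exp (-8)) (hF : IsHammingBall F)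
    (hF₁ : exp (-n) ≤ 1 - mu F) (hF₂ : 1 - mu F ≤ exp (-8)) (hAF : mu A ≤ 2 * (1 - mu F))
    (hFA : 1 - mu F ≤ 2 * mu A) (hF_infl : influence F (Fin.last n) ≤ mu A ^ 2) :
    TightWith 1000 (orFirst A 1) F := by
  have hα₀ : 0 < mu A := (exp_pos _).trans_le hA₁
  have hα : mu A ≤ 1 / 9 := hA₂.trans exp_neg_eight_le
  have hβ : 1 - mu F ≤ 1 / 9 := hF₂.trans exp_neg_eight_le
  have hn : 0 < n := by
    have := exp_le_exp.1 (hA₁.trans hA₂)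
    rify
    linarith
  have infl_nonneg := influence_nonneg F (Fin.last n)
  have infl_mul_nonneg : 0 ≤ (1 - mu A) * influence F (Fin.last n) :=
    mul_nonneg (by linarith) infl_nonneg
  have infl_mul_le : (1 - mu A) * influence F (Fin.last n) ≤ mu A ^ 2 :=
    (mul_le_of_le_one_left infl_nonneg (by linarith)).trans hF_infl
  have sq_le : mu A ^ 2 ≤ mu A ^ 2 * log (mu A)⁻¹ :=
    le_mul_of_one_le_right (sq_nonneg _) (by linarith [eight_le_log_inv hα₀ hA₂])
  have subset_slice : A ⊆ slice F (Fin.last n) false := by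
    refine hA.subset_of_mu_lt (hF.slice _ _) ?_
    rw [hF.increasing.mu_slice_false]
    nlinarith
  obtain ⟨le_mul_infl, mul_infl_le⟩ := hA.mul_influence_mul_influence_mem_Icc hA₁ hA₂ hF hF₁ hF₂
    hAF hFA ⟨0, hn⟩ (Fin.last n)
  refine tightWith_of_bounds (hA.increasing.orFirst 0) hF.increasing hα₀ hA₂ ?_ ?_ ?_ ?_
  · rw [hA.W1_orFirst_one hF ⟨0, hn⟩]
    linarith
  · rw [hA.W1_orFirst_one hF ⟨0, hn⟩]
    linarith
  · rw [hF.increasing.cov_orFirst_one subset_slice]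
    nlinarith
  · rw [hF.increasing.cov_orFirst_one subset_slice]
    nlinarith

/-! ### Existence of balls -/

lemma exists_isHammingBall_abs_mu_sub_le {b : ℝ} (hb₀ : 0 ≤ b) (hb₁ : b < 1) (n : ℕ) :
    ∃ A : Finset (Cube n), IsHammingBall A ∧ |mu A - b| ≤ √(8 / n.succ) := by
  have start : ¬mu (upperBall n 0) ≤ b := by
    rw [upperBall_zero, mu_univ]
    exact hb₁.not_ge
  have finish : ∃ m, mu (upperBall n m) ≤ b := by
    refine ⟨n + 1, ?_⟩
    rw [upperBall_eq_empty n.lt_succ_self]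
    simpa [mu] using hb₀
  obtain ⟨m, lt_mu, mu_le⟩ := Nat.exists_not_and_succ_of_not_zero_of_exists start finish
  rw [not_le] at lt_mu
  have jump := (isHammingBall_upperBall (n + 1) (m + 1)).influence_le_sqrt 0
  rw [influence_upperBall, Nat.add_sub_cancel] at jump
  refine ⟨upperBall n m, isHammingBall_upperBall n m, ?_⟩
  rw [abs_of_pos (sub_pos.2 lt_mu)]
  exact le_trans (by linarith) jump

lemma tendsto_sqrt_eight_div : Tendsto (fun n : ℕ => √(8 / n)) atTop (𝓝 0) := by
  simpa using (tendsto_const_div_atTop_nhds_zero_nat 8).sqrt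

lemma eventually_influence_le {k : ℕ → ℕ} (hk : Tendsto k atTop atTop)
    {F : ∀ n, Finset (Cube (k n))} (hF : ∀ n, IsHammingBall (F n)) {ε : ℝ} (hε : 0 < ε) :
    ∀ᶠ n in atTop, ∀ i, influence (F n) i ≤ ε :=
  ((tendsto_sqrt_eight_div.comp hk).eventually_le_const hε).mono fun n hn i =>
    ((hF n).influence_le_sqrt i).trans hn

lemma exists_isBallSeq {b : ℝ} (hb₀ : 0 ≤ b) (hb₁ : b < 1) {k : ℕ → ℕ}
    (hk : Tendsto k atTop atTop) : ∃ F : ∀ n, Finset (Cube (k n)), IsBallSeq k b F := by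
  choose F hF mu_F using exists_isHammingBall_abs_mu_sub_le hb₀ hb₁
  refine ⟨fun n => F (k n), fun n => hF (k n), tendsto_iff_norm_sub_tendsto_zero.2 ?_⟩
  exact squeeze_zero (fun _ => norm_nonneg _) (fun n => mu_F (k n))
    (tendsto_sqrt_eight_div.comp ((tendsto_add_atTop_nat 1).comp hk))

lemma mu_upperBall_sub_mu_upperBall_succ (n m : ℕ) :
    mu (upperBall n m) - mu (upperBall n (m + 1)) = n.choose m / 2 ^ n := by
  induction n generalizing m with
  | zero =>
    cases m with
    | zero => simp [upperBall_zero, upperBall_eq_empty, mu]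
    | succ m => simp [upperBall_eq_empty, mu]
  | succ n ih =>
    have slices (j : ℕ) : mu (upperBall (n + 1) j) =
        (mu (upperBall n (j - 1)) + mu (upperBall n j)) / 2 := by
      rw [mu_eq_slices _ 0, slice_upperBall, slice_upperBall]
      rfl
    rw [slices, slices, Nat.add_sub_cancel, pow_succ]
    cases m with
    | zero =>
      have ih₀ := ih 0
      rw [Nat.choose_zero_right, Nat.zero_sub, ← div_div] at *
      linarith
    | succ m =>
      rw [Nat.choose_succ_succ', Nat.cast_add, ← div_div, add_div _ _ (2 ^ n), ← ih, ← ih,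
        Nat.add_sub_cancel]
      ring

/-! ### Balanced balls with prescribed influence -/

/-- The balanced Hamming ball in the cube of odd dimension `2 * k + 1`. -/
def majority (k : ℕ) : Finset (Cube (2 * k + 1)) := upperBall (2 * k + 1) (k + 1)

lemma isHammingBall_majority (k : ℕ) : IsHammingBall (majority k) :=
  isHammingBall_upperBall _ _

lemma mu_majority (k : ℕ) : mu (majority k) = 1 / 2 := by
  refine mu_eq_half_of_dual_eq_self ?_
  rw [majority, dual_upperBall]
  congr 1
  omega

lemma influence_majority (k : ℕ) (i : Fin (2 * k + 1)) :
    influence (majority k) i = k.centralBinom / 4 ^ k := by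
  rw [majority, influence_upperBall, Nat.add_sub_cancel, mu_upperBall_sub_mu_upperBall_succ,
    Nat.centralBinom_eq_two_mul_choose, pow_mul]
  norm_num

lemma succ_mul_centralBinom_succ_div (k : ℕ) :
    (k + 1) * ((k + 1).centralBinom / 4 ^ (k + 1) : ℝ) =
      (2 * k + 1) / 2 * (k.centralBinom / 4 ^ k) := by
  have : ((k : ℝ) + 1) * (k + 1).centralBinom = 2 * (2 * k + 1) * k.centralBinom := by
    exact_mod_cast Nat.succ_mul_centralBinom_succ k
  rw [← mul_div_assoc, this, pow_succ]
  ring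

lemma one_le_two_mul_succ_mul_centralBinom_div (k : ℕ) :
    1 ≤ 2 * (k + 1) * ((k + 1).centralBinom / 4 ^ (k + 1) : ℝ) := by
  rw [← mul_div_assoc, one_le_div (by positivity)]
  exact_mod_cast Nat.four_pow_le_two_mul_self_mul_centralBinom (k + 1) k.succ_pos

lemma exists_centralBinom_div_le {t : ℝ} (ht : 0 < t) :
    ∃ k : ℕ, (k.centralBinom / 4 ^ k : ℝ) ≤ t := by
  have dim_tendsto : Tendsto (fun k => 2 * k + 1) atTop atTop :=
    tendsto_atTop_mono (fun k => show k ≤ 2 * k + 1 by omega) tendsto_id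
  obtain ⟨k, hk⟩ := (eventually_influence_le dim_tendsto isHammingBall_majority ht).exists
  exact ⟨k, influence_majority k 0 ▸ hk 0⟩

lemma exists_abs_influence_majority_sub_le {t : ℝ} (ht₀ : 0 < t) (ht₁ : t < 1) :
    ∃ k, ∀ i, |influence (majority k) i - t| ≤ 2 * t ^ 2 := by
  obtain ⟨k, lt_c, c_le⟩ := Nat.exists_not_and_succ_of_not_zero_of_exists
    (p := fun k => (k.centralBinom / 4 ^ k : ℝ) ≤ t) (by simpa using ht₁)
    (exists_centralBinom_div_le ht₀)
  have hrec := succ_mul_centralBinom_succ_div k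
  have hlow := one_le_two_mul_succ_mul_centralBinom_div k
  refine ⟨k + 1, fun i => ?_⟩
  rw [influence_majority, abs_sub_comm, abs_of_nonneg (sub_nonneg.2 c_le)]
  rw [not_le] at lt_c
  set c := (k.centralBinom / 4 ^ k : ℝ)
  set c' := ((k + 1).centralBinom / 4 ^ (k + 1) : ℝ)
  refine le_of_mul_le_mul_left (a := (2 * k + 1 : ℝ)) ?_ (by positivity)
  calc (2 * k + 1) * (t - c') ≤ (2 * k + 1) * (c - c') := by gcongr
    _ = c' := by linarith
    _ ≤ t := c_le
    _ ≤ t * (2 * (k + 1) * t) := le_mul_of_one_le_right ht₀.le (hlow.trans (by gcongr))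
    _ = (2 * k + 2) * t ^ 2 := by ring
    _ ≤ (2 * (2 * k + 1)) * t ^ 2 := by
        gcongr
        linarith [(k.cast_nonneg : (0 : ℝ) ≤ k)]
    _ = (2 * k + 1) * (2 * t ^ 2) := by ring

lemma IsHammingBall.exists_majority_abs_influence_sub_le {B : Finset (Cube n)}
    (hB : IsHammingBall B) (hB₀ : ∀ j, 0 < influence B j) (hB₁ : ∀ j, influence B j < 1) :
    ∃ k, ∀ i j, |influence (majority k) i - influence B j| ≤ 2 * influence B j ^ 2 := by
  cases n with
  | zero => exact ⟨0, fun _ j => j.elim0⟩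
  | succ n =>
    obtain ⟨k, hk⟩ := exists_abs_influence_majority_sub_le (hB₀ 0) (hB₁ 0)
    exact ⟨k, fun i j => hB.influence_eq j 0 ▸ hk i⟩

lemma exists_isMatchingBalanced {B : ∀ n, Finset (Cube n)} (hB : ∀ n, IsHammingBall (B n))
    (hB₀ : ∀ᶠ n in atTop, ∀ j, 0 < influence (B n) j) :
    ∃ (l : ℕ → ℕ) (C : ∀ n, Finset (Cube (l n))), IsMatchingBalanced B l C := by
  have exists_majority : ∀ᶠ n in atTop, ∃ k, ∀ i j,
      |influence (majority k) i - influence (B n) j| ≤ 2 * influence (B n) j ^ 2 := by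
    filter_upwards [hB₀, eventually_influence_le tendsto_id hB one_half_pos] with n hn₀ hn₁
    exact (hB n).exists_majority_abs_influence_sub_le hn₀ fun j => (hn₁ j).trans_lt one_half_lt_one
  obtain ⟨k, hk⟩ := exists_majority.choice
  refine ⟨fun n => 2 * k n + 1, fun n => majority (k n),
    fun n => ⟨isHammingBall_majority _, mu_majority _⟩, fun ε hε => ?_⟩
  filter_upwards [hB₀, eventually_influence_le tendsto_id hB (half_pos hε), hk]
    with n hn₀ hn hkn i j
  calc |influence (majority (k n)) i - influence (B n) j|
      ≤ 2 * influence (B n) j * influence (B n) j := by linarith [hkn i j]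
    _ ≤ ε * influence (B n) j := by gcongr; exacts [(hn₀ j).le, by linarith [hn j]]

/-! ### Asymptotics -/

lemma eventually_mem_Icc_exp {f : ℕ → ℝ} {a : ℝ} (hf : Tendsto f atTop (𝓝 a)) (ha₀ : 0 < a)
    (ha₁ : a < exp (-8)) : ∀ᶠ n : ℕ in atTop, f n ∈ Set.Icc (exp (-n)) (exp (-8)) := by
  have exp_tendsto : Tendsto (fun n : ℕ => exp (-n)) atTop (𝓝 0) :=
    tendsto_exp_neg_atTop_nhds_zero.comp tendsto_natCast_atTop_atTop
  filter_upwards [exp_tendsto.eventually_lt hf ha₀, hf.eventually_lt_const ha₁] with n hn₁ hn₂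
  exact ⟨hn₁.le, hn₂.le⟩

lemma eventually_le_two_mul {f g : ℕ → ℝ} {a : ℝ} (hf : Tendsto f atTop (𝓝 a))
    (hg : Tendsto g atTop (𝓝 a)) (ha : 0 < a) : ∀ᶠ n in atTop, f n ≤ 2 * g n :=
  (hf.eventually_lt (hg.const_mul 2) (by linarith)).mono fun _ => le_of_lt

lemma eventually_tightWith_orFirst_one {A : ∀ n, Finset (Cube n)}
    {F : ∀ n, Finset (Cube (n + 1))} {a : ℝ} (ha₀ : 0 < a) (ha₁ : a < exp (-8))
    (hA : IsBallSeq (fun n => n) a A) (hF : IsBallSeq (fun n => n + 1) (1 - a) F) :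
    ∀ᶠ n in atTop, TightWith 1000 (orFirst (A n) 1) (F n) := by
  obtain ⟨A_ball, A_lim⟩ := hA
  obtain ⟨F_ball, F_lim⟩ := hF
  have compl_lim : Tendsto (fun n => 1 - mu (F n)) atTop (𝓝 a) := by
    simpa using F_lim.const_sub 1
  filter_upwards [eventually_mem_Icc_exp A_lim ha₀ ha₁, eventually_mem_Icc_exp compl_lim ha₀ ha₁,
    eventually_le_two_mul A_lim compl_lim ha₀, eventually_le_two_mul compl_lim A_lim ha₀,
    eventually_influence_le (tendsto_add_atTop_nat 1) F_ball (by positivity : 0 < (a / 2) ^ 2),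
    A_lim.eventually_const_le (half_lt_self ha₀)] with n hA hF hAF hFA F_infl half_le
  exact tightWith_orFirst_one (A_ball n) hA.1 hA.2 (F_ball n) hF.1 hF.2 hAF hFA
    ((F_infl _).trans (by gcongr))

lemma eventually_influence_dual_pos {A : ∀ n, Finset (Cube n)} {a : ℝ} (ha₀ : 0 < a)
    (ha₁ : a < exp (-8)) (hA : IsBallSeq (fun n => n) a A) :
    ∀ᶠ n in atTop, ∀ j, 0 < influence (dual (A n)) j := by
  filter_upwards [eventually_mem_Icc_exp hA.2 ha₀ ha₁] with n ⟨le_mu, mu_le⟩ j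
  rw [influence_dual]
  have mu_pos := (exp_pos _).trans_le le_mu
  have log_pos : 0 < log (mu (A n))⁻¹ := by linarith [eight_le_log_inv mu_pos mu_le]
  have le_infl := (hA.1 n).le_mul_influence_sq le_mu mu_le j
  refine (influence_nonneg _ _).lt_of_ne' fun infl_eq_zero => ?_
  rw [infl_eq_zero] at le_infl
  have : 0 < mu (A n) ^ 2 * log (mu (A n))⁻¹ := by positivity
  linarith

lemma eventually_tightWith_orFirst_andFamily_dual {A : ∀ n, Finset (Cube n)} {a : ℝ}
    (ha₀ : 0 < a) (ha₁ : a < exp (-8)) (hA : IsBallSeq (fun n => n) a A) {l : ℕ → ℕ}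
    {C : ∀ n, Finset (Cube (l n))} (hC : IsMatchingBalanced (fun n => dual (A n)) l C) :
    ∀ᶠ n in atTop, TightWith 1000 (orFirst (A n) (l n)) (andFamily (dual (A n)) (C n)) := by
  obtain ⟨A_ball, A_lim⟩ := hA
  obtain ⟨C_ball, matching⟩ := hC
  filter_upwards [eventually_mem_Icc_exp A_lim ha₀ ha₁, matching 1 one_pos,
    eventually_influence_le tendsto_id A_ball (by positivity : 0 < (a / 2) ^ 2 / 2),
    A_lim.eventually_const_le (half_lt_self ha₀), eventually_gt_atTop 0]
    with n ⟨le_mu, mu_le⟩ match_n A_infl half_le n_pos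
  refine tightWith_orFirst_andFamily_dual (A_ball n) le_mu mu_le (C_ball n).1.increasing
    (C_ball n).2 fun i => ?_
  have close := (abs_le.1 (match_n i ⟨0, n_pos⟩)).2
  rw [influence_dual] at close
  calc influence (C n) i ≤ (a / 2) ^ 2 := by linarith [A_infl ⟨0, n_pos⟩]
    _ ≤ mu (A n) ^ 2 := by gcongr

end DiscreteCube

theorem mainTheorem9 :
    ∃ a₀ : ℝ, 0 < a₀ ∧ ∃ K : ℝ, 0 < K ∧ ∀ a : ℝ, 0 < a → a < a₀ →
      (∃ A : ∀ n, Finset (DiscreteCube.Cube n), DiscreteCube.IsBallSeq (fun n => n) a A) ∧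
      (∃ B' : ∀ n, Finset (DiscreteCube.Cube (n + 1)),
        DiscreteCube.IsBallSeq (fun n => n + 1) (1 - a) B') ∧
      ∀ A : ∀ n, Finset (DiscreteCube.Cube n), DiscreteCube.IsBallSeq (fun n => n) a A →
      ∀ B : ∀ n, Finset (DiscreteCube.Cube n), (∀ n, B n = DiscreteCube.dual (A n)) →
        (∀ B' : ∀ n, Finset (DiscreteCube.Cube (n + 1)),
          DiscreteCube.IsBallSeq (fun n => n + 1) (1 - a) B' →
          ∀ᶠ n in atTop, DiscreteCube.TightWith K (DiscreteCube.orFirst (A n) 1) (B' n)) ∧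
        (∃ (l : ℕ → ℕ) (C : ∀ n, Finset (DiscreteCube.Cube (l n))),
          DiscreteCube.IsMatchingBalanced B l C) ∧
        (∀ (l : ℕ → ℕ) (C : ∀ n, Finset (DiscreteCube.Cube (l n))),
          DiscreteCube.IsMatchingBalanced B l C →
          ∀ᶠ n in atTop, DiscreteCube.TightWith K (DiscreteCube.orFirst (A n) (l n))
            (DiscreteCube.andFamily (B n) (C n))) := by
  open DiscreteCube in
  refine ⟨Real.exp (-8), Real.exp_pos _, 1000, by norm_num, fun a ha₀ ha₁ => ?_⟩
  have a_lt_one : a < 1 := ha₁.trans_le (by linarith [exp_neg_eight_le])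
  refine ⟨exists_isBallSeq ha₀.le a_lt_one tendsto_id,
    exists_isBallSeq (by linarith) (by linarith) (tendsto_add_atTop_nat 1), fun A hA B hB => ?_⟩
  obtain rfl : B = fun n => dual (A n) := funext hB
  exact ⟨fun F hF => eventually_tightWith_orFirst_one ha₀ ha₁ hA hF,
    exists_isMatchingBalanced (fun n => (hA.1 n).dual) (eventually_influence_dual_pos ha₀ ha₁ hA),
    fun l C hC => eventually_tightWith_orFirst_andFamily_dual ha₀ ha₁ hA hC⟩
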